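/- Let $\mathbf S=\langle\{0,h,1\};+,\cdot,0,1\rangle$ be the three-element Boolean semiring: multiplication is the minimum for the order $0<h<1$; $0$ is neutral for addition, which is commutative, and $h+h=h$, $h+1=1$, $1+1=h$. Let $\mathcal A=ISP(\mathbf S)$ be the quasi-variety it generates, i.e. the class of all semirings isomorphic to a subalgebra of a (possibly empty) power of $\mathbf S$, with semiring homomorphisms (preserving $0$ and $1$). On $S=\{0,h,1\}$ let $$r_1=S^2\setminus\{(1,0)\},\quad r_2=S^2\setminus\{(h,0),(1,0)\},\quad r_3=S^2\setminus\{(0,1),(h,1),(1,0),(1,h)\},$$ let $\lambda_1$ be the binary partial operation with domain $r_1$ given by $$\lambda_1(0,0)=0,\ \lambda_1(h,h)=h,\ \lambda_1(1,1)=1,\ \lambda_1(0,h)=h,\ \lambda_1(0,1)=h,\ \lambda_1(h,0)=0,\ \lambda_1(h,1)=h,\ \lambda_1(1,h)=1,$$ and let $\mathcal T$ be the discrete topology. (The three relations and the graph of $\lambda_1$ are subalgebras of powers of $\mathbf S$.) Put $\mathbb S=\langle S;\{r_1,r_2,r_3\},\{\lambda_1\},\mathcal T\rangle$. Let $\mathcal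 X=IS_cP^+(\mathbb S)$ be the category of all structured topological spaces isomorphic to a topologically closed (possibly empty) substructure of a power $\mathbb S^{\Omega}$ with $\Omega\neq\emptyset$, where the structure on powers is pointwise, a substructure is a subset closed under the partial operation, and morphisms are the continuous maps that preserve the relations and the partial operation (including its domain). For $A\in\mathcal A$ let $D(A)=\mathcal A(A,\mathbf S)\subseteq\mathbb S^{A}$, and for $X\in\mathcal X$ let $E(X)=\mathcal X(X,\mathbb S)\subseteq\mathbf S^{X}$, with the inherited structure. Then $\mathbb S$ yields a strong duality on $\mathcal A$; that is: 1. for every $A\in\mathcal A$ the evaluation map $e_A:A\to ED(A)$, $e_A(a)(\varphi)=\varphi(a)$, is an isomorphism; 2. for every $X\in\mathcal X$ the evaluation map $\varepsilon_X:X\to DE(X)$, $\varepsilon_X(x)(\alpha)=\alpha(x)$, is an isomorphism of structured topological spaces; 3. $\mathbb S$ is injective in $\mathcal X$: for every embedding $f:X\to Y$ in $\mathcal X$ (a morphism that is an isomorphism onto a substructure of $Y$) and every morphism $\alpha:X\to\mathbb S$ there is a morphism $\beta:Y\to\mathbb S$ with $\beta\circ f=\alpha$. -/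

import Mathlib

universe u v w

namespace NatDual

/-! ## The three-element Boolean semiring -/

/-- The carrier `{0, h, 1}` of the three-element Boolean semiring. -/
inductive S : Type
  | zero : S
  | h : S
  | one : S
  deriving DecidableEq

namespace S

instance : Fintype S := ⟨{zero, h, one}, by rintro (_ | _ | _) <;> decide⟩

/-- Addition: `0` is neutral, `h + h = h`, `h + 1 = 1 + h = 1` and `1 + 1 = h`. -/
def add : S → S → S
  | zero, y => y
  | x, zero => x
  | h, h => h
  | h, one => one
  | one, h => one
  | one, one => h

/-- Multiplication is the minimum for `0 < h < 1`. -/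
def mul : S → S → S
  | zero, _ => zero
  | _, zero => zero
  | h, _ => h
  | _, h => h
  | one, one => one

/-- The algebra `⟨S; +, ·, 0, 1⟩`. It is the subsemiring generated by `1` in the product of the
two-element ring and the two-element lattice (`h = 1 + 1`). -/
instance : CommSemiring S where
  add := add
  mul := mul
  zero := zero
  one := one
  nsmul := @nsmulRec S ⟨zero⟩ ⟨add⟩
  add_assoc := show ∀ a b c : S, add (add a b) c = add a (add b c) by decide
  zero_add := show ∀ a : S, add zero a = a by decide
  add_zero := show ∀ a : S, add a zero = a by decide
  add_comm := show ∀ a b : S, add a b = add b a by decide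
  mul_assoc := show ∀ a b c : S, mul (mul a b) c = mul a (mul b c) by decide
  one_mul := show ∀ a : S, mul one a = a by decide
  mul_one := show ∀ a : S, mul a one = a by decide
  mul_comm := show ∀ a b : S, mul a b = mul b a by decide
  left_distrib := show ∀ a b c : S, mul a (add b c) = add (mul a b) (mul a c) by decide
  right_distrib := show ∀ a b c : S, mul (add a b) c = add (mul a c) (mul b c) by decide
  zero_mul := show ∀ a : S, mul zero a = zero by decide
  mul_zero := show ∀ a : S, mul a zero = zero by decide

/-- The discrete topology. -/
instance : TopologicalSpace S := ⊥

instance : DiscreteTopology S := ⟨rfl⟩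

end S

/-- Membership in the quasi-variety `ISP(S)`: `A` is isomorphic to a subalgebra of a (possibly
empty) power of `S`. -/
def InISP (A : Type u) [CommSemiring A] : Prop :=
  ∃ (I : Type u) (B : Subsemiring (I → S)), Nonempty (A ≃+* B)

/-! ## Structured topological spaces -/

/-- The type of a structured topological space: index sets and arities for the total operations
`G`, the partial operations `H` and the relations `R`. -/
structure Sig where
  G : Type
  H : Type
  R : Type
  arG : G → ℕ
  arH : H → ℕ
  arR : R → ℕ

/-- A structured topological space `⟨X; G, H, R, 𝒯⟩`. It may be empty. -/
structure StrSpace (τ : Sig) where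
  carrier : Type u
  top : TopologicalSpace carrier
  op : ∀ g : τ.G, (Fin (τ.arG g) → carrier) → carrier
  dom : ∀ k : τ.H, Set (Fin (τ.arH k) → carrier)
  pop : ∀ k : τ.H, dom k → carrier
  rel : ∀ r : τ.R, Set (Fin (τ.arR r) → carrier)

instance (τ : Sig) : CoeSort (StrSpace.{u} τ) (Type u) := ⟨StrSpace.carrier⟩

instance {τ : Sig} (X : StrSpace.{u} τ) : TopologicalSpace X := X.top

variable {τ : Sig}

/-- Morphisms: continuous maps that preserve the total operations, the partial operations (with
their domains) and the relations. -/
structure IsHom (X : StrSpace.{u} τ) (Y : StrSpace.{v} τ) (f : X → Y) : Prop where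
  continuous : Continuous f
  map_op : ∀ (g : τ.G) (x : Fin (τ.arG g) → X), f (X.op g x) = Y.op g (f ∘ x)
  map_pop : ∀ (k : τ.H) (x : Fin (τ.arH k) → X) (hx : x ∈ X.dom k),
    ∃ hy : f ∘ x ∈ Y.dom k, f (X.pop k ⟨x, hx⟩) = Y.pop k ⟨f ∘ x, hy⟩
  map_rel : ∀ (r : τ.R) (x : Fin (τ.arR r) → X), x ∈ X.rel r → f ∘ x ∈ Y.rel r

/-- Isomorphisms: morphisms with a two-sided inverse morphism. -/
def IsIsom (X : StrSpace.{u} τ) (Y : StrSpace.{v} τ) (f : X → Y) : Prop :=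
  IsHom X Y f ∧ ∃ g : Y → X, IsHom Y X g ∧ Function.LeftInverse g f ∧ Function.RightInverse g f

/-- Embeddings: morphisms that are isomorphisms onto a substructure of the codomain. -/
structure IsEmb (X : StrSpace.{u} τ) (Y : StrSpace.{v} τ) (f : X → Y) : Prop where
  isHom : IsHom X Y f
  isEmbedding : Topology.IsEmbedding f
  reflect_dom : ∀ (k : τ.H) (x : Fin (τ.arH k) → X), f ∘ x ∈ Y.dom k → x ∈ X.dom k
  reflect_rel : ∀ (r : τ.R) (x : Fin (τ.arR r) → X), f ∘ x ∈ Y.rel r → x ∈ X.rel r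

/-- The power `X ^ Ω`, with the product topology and everything else defined pointwise. -/
def StrSpace.power (X : StrSpace.{v} τ) (Ω : Type w) : StrSpace.{max v w} τ where
  carrier := Ω → X
  top := inferInstance
  op g x := fun ω => X.op g (fun i => x i ω)
  dom k := {x | ∀ ω, (fun i => x i ω) ∈ X.dom k}
  pop k x := fun ω => X.pop k ⟨fun i => x.1 i ω, x.2 ω⟩
  rel r := {x | ∀ ω, (fun i => x i ω) ∈ X.rel r}

/-- A subset carries a substructure if it is closed under the total and the partial operations. -/
structure IsSub (X : StrSpace.{u} τ) (C : Set X) : Prop where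
  op_mem : ∀ (g : τ.G) (x : Fin (τ.arG g) → X), (∀ i, x i ∈ C) → X.op g x ∈ C
  pop_mem : ∀ (k : τ.H) (x : Fin (τ.arH k) → X) (hx : x ∈ X.dom k),
    (∀ i, x i ∈ C) → X.pop k ⟨x, hx⟩ ∈ C

/-- The substructure on `C`, with all the structure restricted to `C`. -/
def StrSpace.sub (X : StrSpace.{u} τ) (C : Set X) (hC : IsSub X C) : StrSpace.{u} τ where
  carrier := C
  top := inferInstance
  op g x := ⟨X.op g (fun i => (x i : X)), hC.op_mem g _ fun i => (x i).2⟩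
  dom k := {x | (fun i => (x i : X)) ∈ X.dom k}
  pop k x := ⟨X.pop k ⟨fun i => (x.1 i : X), x.2⟩, hC.pop_mem k _ x.2 fun i => (x.1 i).2⟩
  rel r := {x | (fun i => (x i : X)) ∈ X.rel r}

/-! ## Algebraic structures on `S` and the dualities they yield -/

/-- A structure `⟨S; G, H, R, 𝒯⟩` on the set `S` that is algebraic over the semiring `S`: total
operations are homomorphisms `Sⁿ → S`, partial operations are homomorphisms from subalgebras of
`Sⁿ` to `S`, relations are subalgebras of `Sⁿ`. -/
structure AlterEgo (τ : Sig) where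
  op : ∀ g : τ.G, (Fin (τ.arG g) → S) →+* S
  dom : ∀ k : τ.H, Subsemiring (Fin (τ.arH k) → S)
  pop : ∀ k : τ.H, dom k →+* S
  rel : ∀ r : τ.R, Subsemiring (Fin (τ.arR r) → S)

/-- An algebraic structure on `S`, as a structured space with the discrete topology. -/
def AlterEgo.toStrSpace (M : AlterEgo τ) : StrSpace.{0} τ where
  carrier := S
  top := inferInstanceAs (TopologicalSpace S)
  op g := M.op g
  dom k := M.dom k
  pop k := M.pop k
  rel r := M.rel r

/-- Membership in the category `IS_cP⁺(M)`: `X` is isomorphic to a closed (possibly empty)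
substructure of a power of `M` with non-empty exponent. Its morphisms are given by `IsHom`. -/
def InIScP (M : AlterEgo τ) (X : StrSpace.{u} τ) : Prop :=
  ∃ (Ω : Type u) (C : Set (M.toStrSpace.power Ω)) (hC : IsSub (M.toStrSpace.power Ω) C),
    Nonempty Ω ∧ IsClosed C ∧ ∃ f, IsIsom X ((M.toStrSpace.power Ω).sub C hC) f

/-- The dual `D(A)`: the set of homomorphisms `A → S`, with the structure inherited from the
power `M ^ A`. -/
def dualD (M : AlterEgo τ) (A : Type u) [CommSemiring A] : StrSpace.{u} τ where
  carrier := A →+* S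
  top := TopologicalSpace.induced (fun φ : A →+* S => (φ : A → S)) inferInstance
  op g x := (M.op g).comp (RingHom.pi x)
  dom k := {x | ∀ a, (fun i => x i a) ∈ M.dom k}
  pop k x := (M.pop k).comp ((RingHom.pi x.1).codRestrict (M.dom k) x.2)
  rel r := {x | ∀ a, (fun i => x i a) ∈ M.rel r}

/-- The dual `E(X)`: the algebra of all morphisms `X → M`, a subalgebra of `S ^ X`. -/
def dualE (M : AlterEgo τ) (X : StrSpace.{u} τ) : Subsemiring (X → S) where
  carrier := {α | IsHom X M.toStrSpace α}
  zero_mem' :=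
    { continuous := continuous_const
      map_op := fun g _ => (map_zero (M.op g)).symm
      map_pop := fun k _ _ => ⟨(M.dom k).zero_mem, (map_zero (M.pop k)).symm⟩
      map_rel := fun r _ _ => (M.rel r).zero_mem }
  one_mem' :=
    { continuous := continuous_const
      map_op := fun g _ => (map_one (M.op g)).symm
      map_pop := fun k _ _ => ⟨(M.dom k).one_mem, (map_one (M.pop k)).symm⟩
      map_rel := fun r _ _ => (M.rel r).one_mem }
  add_mem' := by
    intro α β hα hβ
    refine ⟨?_, ?_, ?_, ?_⟩
    · have hadd : Continuous fun p : S × S => p.1 + p.2 := continuous_of_discreteTopology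
      exact hadd.comp (Continuous.prodMk (X := S) (Y := S) (Z := X) hα.continuous hβ.continuous)
    · intro g x
      exact (congrArg₂ (fun a b : S => a + b) (hα.map_op g x) (hβ.map_op g x)).trans
        (map_add (M.op g) (α ∘ x) (β ∘ x)).symm
    · intro k x hx
      obtain ⟨h1, e1⟩ := hα.map_pop k x hx
      obtain ⟨h2, e2⟩ := hβ.map_pop k x hx
      exact ⟨(M.dom k).add_mem h1 h2, (congrArg₂ (fun a b : S => a + b) e1 e2).trans
        (map_add (M.pop k) ⟨α ∘ x, h1⟩ ⟨β ∘ x, h2⟩).symm⟩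
    · intro r x hx
      exact (M.rel r).add_mem (hα.map_rel r x hx) (hβ.map_rel r x hx)
  mul_mem' := by
    intro α β hα hβ
    refine ⟨?_, ?_, ?_, ?_⟩
    · have hmul : Continuous fun p : S × S => p.1 * p.2 := continuous_of_discreteTopology
      exact hmul.comp (Continuous.prodMk (X := S) (Y := S) (Z := X) hα.continuous hβ.continuous)
    · intro g x
      exact (congrArg₂ (fun a b : S => a * b) (hα.map_op g x) (hβ.map_op g x)).trans
        (map_mul (M.op g) (α ∘ x) (β ∘ x)).symm
    · intro k x hx
      obtain ⟨h1, e1⟩ := hα.map_pop k x hx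
      obtain ⟨h2, e2⟩ := hβ.map_pop k x hx
      exact ⟨(M.dom k).mul_mem h1 h2, (congrArg₂ (fun a b : S => a * b) e1 e2).trans
        (map_mul (M.pop k) ⟨α ∘ x, h1⟩ ⟨β ∘ x, h2⟩).symm⟩
    · intro r x hx
      exact (M.rel r).mul_mem (hα.map_rel r x hx) (hβ.map_rel r x hx)

/-- Evaluation at an element of `A` is a morphism `D(A) → M`. -/
theorem eval_mem_dualE (M : AlterEgo τ) (A : Type u) [CommSemiring A] (a : A) :
    (fun φ : A →+* S => φ a) ∈ dualE M (dualD M A) where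
  continuous := (continuous_apply a).comp continuous_induced_dom
  map_op _ _ := rfl
  map_pop _ _ hx := ⟨hx a, rfl⟩
  map_rel _ _ hx := hx a

/-- The evaluation homomorphism `e_A : A → ED(A)`, `e_A(a)(φ) = φ(a)`. -/
def evalHom (M : AlterEgo τ) (A : Type u) [CommSemiring A] : A →+* dualE M (dualD M A) where
  toFun a := ⟨fun φ : A →+* S => φ a, eval_mem_dualE M A a⟩
  map_zero' := Subtype.ext (funext fun φ : A →+* S => map_zero φ)
  map_one' := Subtype.ext (funext fun φ : A →+* S => map_one φ)
  map_add' a b := Subtype.ext (funext fun φ : A →+* S => map_add φ a b)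
  map_mul' a b := Subtype.ext (funext fun φ : A →+* S => map_mul φ a b)

/-- The evaluation map `ε_X : X → DE(X)`, `ε_X(x)(α) = α(x)`. -/
def evalPt (M : AlterEgo τ) (X : StrSpace.{u} τ) (x : X) : dualD M (dualE M X) :=
  (Pi.evalRingHom (fun _ : X => S) x).comp (dualE M X).subtype

/-- `E` takes values in `ISP(S)`. -/
theorem inISP_dualE (M : AlterEgo τ) (X : StrSpace.{u} τ) : InISP (dualE M X) :=
  ⟨X, dualE M X, ⟨RingEquiv.refl _⟩⟩

/-- `D` takes values in `IS_cP⁺(M)`. -/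
theorem inIScP_dualD (M : AlterEgo τ) (A : Type u) [CommSemiring A] :
    InIScP M (dualD M A) := by
  have hC : IsSub (M.toStrSpace.power A) (Set.range fun φ : A →+* S => (φ : A → S)) := by
    constructor
    · intro g x hx
      choose φ hφ using hx
      obtain rfl : (fun i => (φ i : A → S)) = x := funext hφ
      exact ⟨(dualD M A).op g φ, rfl⟩
    · intro k x hx hxC
      choose φ hφ using hxC
      obtain rfl : (fun i => (φ i : A → S)) = x := funext hφ
      exact ⟨(dualD M A).pop k ⟨φ, hx⟩, rfl⟩
  refine ⟨A, _, hC, ⟨0⟩, ?_, fun φ : A →+* S => ⟨(φ : A → S), φ, rfl⟩, ?_, fun f => f.2.choose, ?_, ?_, ?_⟩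
  · have : (Set.range fun φ : A →+* S => (φ : A → S)) =
        {f | f 0 = 0} ∩ {f | f 1 = 1} ∩ (⋂ a, ⋂ b, {f | f (a + b) = f a + f b}) ∩
          (⋂ a, ⋂ b, {f | f (a * b) = f a * f b}) := by
      ext f
      simp only [Set.mem_range, Set.mem_inter_iff, Set.mem_ofPred_eq, Set.mem_iInter]
      constructor
      · rintro ⟨φ, rfl⟩
        exact ⟨⟨⟨map_zero φ, map_one φ⟩, map_add φ⟩, map_mul φ⟩
      · rintro ⟨⟨⟨h0, h1⟩, h2⟩, h3⟩
        exact ⟨{ toFun := f, map_zero' := h0, map_one' := h1, map_add' := h2, map_mul' := h3 }, rfl⟩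
    change IsClosed (X := A → S) (Set.range fun φ : A →+* S => (φ : A → S))
    rw [this]
    have hadd : Continuous fun p : S × S => p.1 + p.2 := continuous_of_discreteTopology
    have hmul : Continuous fun p : S × S => p.1 * p.2 := continuous_of_discreteTopology
    have hadd' : ∀ a b : A, Continuous fun f : A → S => f a + f b := fun a b =>
      hadd.comp₂ (continuous_apply a) (continuous_apply b)
    have hmul' : ∀ a b : A, Continuous fun f : A → S => f a * f b := fun a b =>
      hmul.comp₂ (continuous_apply a) (continuous_apply b)
    refine (((isClosed_eq (continuous_apply _) continuous_const).inter
      (isClosed_eq (continuous_apply _) continuous_const)).inter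
      (isClosed_iInter fun a => isClosed_iInter fun b =>
        isClosed_eq (continuous_apply _) (hadd' a b))).inter
      (isClosed_iInter fun a => isClosed_iInter fun b =>
        isClosed_eq (continuous_apply _) (hmul' a b))
  · refine ⟨continuous_induced_dom.subtype_mk _, fun _ _ => rfl, fun _ _ hx => ⟨hx, rfl⟩,
      fun _ _ hx => hx⟩
  · have key : ∀ f : ((M.toStrSpace.power A).sub _ hC), (f.2.choose : A → S) = f.1 :=
      fun f => f.2.choose_spec
    have inj : Function.Injective fun φ : A →+* S => (φ : A → S) := DFunLike.coe_injective
    refine ⟨?_, ?_, ?_, ?_⟩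
    · refine continuous_induced_rng.2 ?_
      exact (continuous_subtype_val (X := A → S)).congr fun f => (key f).symm
    · intro g x
      refine inj ((key _).trans ?_)
      funext a
      exact congrArg (M.op g) (funext fun i => congrFun (key (x i)).symm a)
    · intro k x hx
      have hx' : ∀ a, (fun i => (x i).2.choose a) ∈ M.dom k := fun a => by
        have : (fun i => (x i).2.choose a) = fun i => (x i).1 a :=
          funext fun i => congrFun (key (x i)) a
        rw [this]; exact hx a
      refine ⟨hx', inj ((key _).trans ?_)⟩
      funext a
      exact congrArg (M.pop k) (Subtype.ext (funext fun i => congrFun (key (x i)).symm a))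
    · intro r x hx a
      have : (fun i => (x i).2.choose a) = fun i => (x i).1 a :=
        funext fun i => congrFun (key (x i)) a
      change (fun i => (x i).2.choose a) ∈ M.rel r
      rw [this]; exact hx a
  · intro (φ : A →+* S)
    exact DFunLike.coe_injective (F := A →+* S)
      (Exists.choose_spec (p := fun ψ : A →+* S => (ψ : A → S) = φ) ⟨φ, rfl⟩)
  · intro f
    exact Subtype.ext f.2.choose_spec

/-- `M` yields a (natural) duality on `ISP(S)`: every `e_A : A → ED(A)` is an isomorphism. -/
def YieldsDuality (M : AlterEgo τ) : Prop :=
  ∀ (A : Type u) [CommSemiring A], InISP A → Function.Bijective (evalHom M A)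

/-- `M` yields a full duality on `ISP(S)`: it yields a duality and every `ε_X : X → DE(X)` is an
isomorphism, so that `D` and `E` form a dual equivalence. -/
def YieldsFullDuality (M : AlterEgo τ) : Prop :=
  YieldsDuality.{u} M ∧
    ∀ X : StrSpace.{u} τ, InIScP M X → IsIsom X (dualD M (dualE M X)) (evalPt M X)

/-- `M` is injective in `IS_cP⁺(M)`: morphisms into `M` extend along embeddings. -/
def IsInjectiveIn (M : AlterEgo τ) : Prop :=
  ∀ X Y : StrSpace.{u} τ, InIScP M X → InIScP M Y →
    ∀ f : X → Y, IsEmb X Y f →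
      ∀ α : X → M.toStrSpace, IsHom X M.toStrSpace α →
        ∃ β : Y → M.toStrSpace, IsHom Y M.toStrSpace β ∧ β ∘ f = α

/-- `M` yields a strong duality on `ISP(S)`: it yields a full duality and is injective in
`IS_cP⁺(M)`. -/
def YieldsStrongDuality (M : AlterEgo τ) : Prop :=
  YieldsFullDuality.{u} M ∧ IsInjectiveIn.{u} M

/-! ## The structure `⟨S; {r₁, r₂, r₃}, {λ₁}, 𝒯⟩` -/

/-- `r₁ = S² \ {(1, 0)}`. -/
def r₁ : Subsemiring (Fin 2 → S) where
  carrier := {x | (x 0, x 1) ∉ ({(1, 0)} : Finset (S × S))}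
  zero_mem' := by decide
  one_mem' := by decide
  add_mem' {x y} := (show ∀ a b c d : S, (a, b) ∉ ({(1, 0)} : Finset (S × S)) →
    (c, d) ∉ ({(1, 0)} : Finset (S × S)) → (a + c, b + d) ∉ ({(1, 0)} : Finset (S × S))
    by decide) (x 0) (x 1) (y 0) (y 1)
  mul_mem' {x y} := (show ∀ a b c d : S, (a, b) ∉ ({(1, 0)} : Finset (S × S)) →
    (c, d) ∉ ({(1, 0)} : Finset (S × S)) → (a * c, b * d) ∉ ({(1, 0)} : Finset (S × S))
    by decide) (x 0) (x 1) (y 0) (y 1)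

/-- `r₂ = S² \ {(h, 0), (1, 0)}`. -/
def r₂ : Subsemiring (Fin 2 → S) where
  carrier := {x | (x 0, x 1) ∉ ({(S.h, 0), (1, 0)} : Finset (S × S))}
  zero_mem' := by decide
  one_mem' := by decide
  add_mem' {x y} := (show ∀ a b c d : S, (a, b) ∉ ({(S.h, 0), (1, 0)} : Finset (S × S)) →
    (c, d) ∉ ({(S.h, 0), (1, 0)} : Finset (S × S)) →
    (a + c, b + d) ∉ ({(S.h, 0), (1, 0)} : Finset (S × S))
    by decide) (x 0) (x 1) (y 0) (y 1)
  mul_mem' {x y} := (show ∀ a b c d : S, (a, b) ∉ ({(S.h, 0), (1, 0)} : Finset (S × S)) →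
    (c, d) ∉ ({(S.h, 0), (1, 0)} : Finset (S × S)) →
    (a * c, b * d) ∉ ({(S.h, 0), (1, 0)} : Finset (S × S))
    by decide) (x 0) (x 1) (y 0) (y 1)

/-- `r₃ = S² \ {(0, 1), (h, 1), (1, 0), (1, h)}`. -/
def r₃ : Subsemiring (Fin 2 → S) where
  carrier := {x | (x 0, x 1) ∉ ({(0, 1), (S.h, 1), (1, 0), (1, S.h)} : Finset (S × S))}
  zero_mem' := by decide
  one_mem' := by decide
  add_mem' {x y} := (show ∀ a b c d : S,
    (a, b) ∉ ({(0, 1), (S.h, 1), (1, 0), (1, S.h)} : Finset (S × S)) →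
    (c, d) ∉ ({(0, 1), (S.h, 1), (1, 0), (1, S.h)} : Finset (S × S)) →
    (a + c, b + d) ∉ ({(0, 1), (S.h, 1), (1, 0), (1, S.h)} : Finset (S × S))
    by decide) (x 0) (x 1) (y 0) (y 1)
  mul_mem' {x y} := (show ∀ a b c d : S,
    (a, b) ∉ ({(0, 1), (S.h, 1), (1, 0), (1, S.h)} : Finset (S × S)) →
    (c, d) ∉ ({(0, 1), (S.h, 1), (1, 0), (1, S.h)} : Finset (S × S)) →
    (a * c, b * d) ∉ ({(0, 1), (S.h, 1), (1, 0), (1, S.h)} : Finset (S × S))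
    by decide) (x 0) (x 1) (y 0) (y 1)

/-- The table of `λ₁`; the value at `(1, 0)`, which is outside the domain `r₁`, is never used. -/
def lam₁Table : S → S → S
  | .zero, .zero => .zero
  | .h, .h => .h
  | .one, .one => .one
  | .zero, .h => .h
  | .zero, .one => .h
  | .h, .zero => .zero
  | .h, .one => .h
  | .one, .h => .one
  | .one, .zero => .zero

/-- The binary partial operation `λ₁` with domain `r₁` and graph
`{000, hhh, 111, 0hh, 01h, h00, h1h, 1h1}`. -/
def lam₁ : r₁ →+* S where
  toFun x := lam₁Table (x.1 0) (x.1 1)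
  map_zero' := rfl
  map_one' := rfl
  map_add' x y := (show ∀ a b c d : S, (a, b) ∉ ({(1, 0)} : Finset (S × S)) →
    (c, d) ∉ ({(1, 0)} : Finset (S × S)) →
    lam₁Table (a + c) (b + d) = lam₁Table a b + lam₁Table c d
    by decide) (x.1 0) (x.1 1) (y.1 0) (y.1 1) x.2 y.2
  map_mul' x y := (show ∀ a b c d : S, (a, b) ∉ ({(1, 0)} : Finset (S × S)) →
    (c, d) ∉ ({(1, 0)} : Finset (S × S)) →
    lam₁Table (a * c) (b * d) = lam₁Table a b * lam₁Table c d
    by decide) (x.1 0) (x.1 1) (y.1 0) (y.1 1) x.2 y.2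

/-- No total operations, one binary partial operation, three binary relations. -/
def smallSig : Sig where
  G := Empty
  H := Unit
  R := Fin 3
  arG := Empty.elim
  arH _ := 2
  arR _ := 2

/-- The structure `⟨S; {r₁, r₂, r₃}, {λ₁}, 𝒯⟩`. -/
def smallStructure : AlterEgo smallSig where
  op g := g.elim
  dom _ := r₁
  pop _ := lam₁
  rel := ![r₁, r₂, r₃]

end NatDual

namespace NatDual

/-! ### Finite computations in `S`: the majority term -/

namespace S

/-! Since `xy + yz + zx` is a majority term on `S`, the Baker–Pixley argument reduces interpolation
to pairs of points: an algebra of continuous functions on a compact space contains every continuous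
`α` that it matches at any two points (`mem_of_forall_pair`). The values of the algebra at two
points form a subalgebra of `S²`, and each such subalgebra is an intersection of `r₁`, `r₂`, `r₃`
and their converses (`mem_of_forall_rel`). So an algebra of morphisms that determines the relations
contains all morphisms (`mem_of_mem_dualE`). For the evaluations on `D(A)` this gives the duality;
for restrictions along an embedding it gives injectivity.

Fullness is where `λ₁` enters. `S` sits inside the product of the two-element ring and the
two-element lattice, so a homomorphism `u : E(X) → S` is determined by where it is `1` and where it
is `0`. By compactness a point `x` realises the first set and a point `y` the second, possibly with
`x ≠ y`. The operation `λ₁` takes "is `1`" from its first argument and "is `0`" from its second, so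
`λ₁(x, y)` realises `u`. -/

theorem exists_eq (s : S) : s = 0 ∨ s = h ∨ s = 1 := by
  rcases s with _ | _ | _
  · exact Or.inl rfl
  · exact Or.inr (Or.inl rfl)
  · exact Or.inr (Or.inr rfl)

/-- `xy + yz + zx` is a majority term. -/
theorem majority_left : ∀ a b : S, a * a + a * b + b * a = a := by decide

theorem majority_mid : ∀ a b : S, a * b + b * a + a * a = a := by decide

theorem majority_right : ∀ a b : S, b * a + a * a + a * b = a := by decide

end S

/-! ### Subalgebras of `S²` -/

/-- A subalgebra of `S²` contains every pair that satisfies all the relations `r₁`, `r₂`, `r₃`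
satisfied by the subalgebra, provided the first coordinate is the larger one. -/
theorem mem_of_forall_rel_of_le (B : Subsemiring (S × S)) {a b : S}
    (hB : ∀ i : Fin 3, (∀ p ∈ B, ![p.1, p.2] ∈ smallStructure.rel i) →
      ![a, b] ∈ smallStructure.rel i)
    (hab : a * b = b) : (a, b) ∈ B := by
  have h00 : ((0, 0) : S × S) ∈ B := B.zero_mem
  have h11 : ((1, 1) : S × S) ∈ B := B.one_mem
  have hhh : ((S.h, S.h) : S × S) ∈ B := B.add_mem h11 h11
  have key : ∀ F : Finset (S × S), (∀ q ∈ F, q ∉ B) → ∀ p ∈ B, p ∉ F :=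
    fun F hF p hp hpF => hF p hpF hp
  have e1 : ∀ x y : S, ![x, y] ∈ smallStructure.rel (0 : Fin 3) ↔
      (x, y) ∉ ({(1, 0)} : Finset (S × S)) := fun _ _ => Iff.rfl
  have e2 : ∀ x y : S, ![x, y] ∈ smallStructure.rel (1 : Fin 3) ↔
      (x, y) ∉ ({(S.h, 0), (1, 0)} : Finset (S × S)) := fun _ _ => Iff.rfl
  have e3 : ∀ x y : S, ![x, y] ∈ smallStructure.rel (2 : Fin 3) ↔
      (x, y) ∉ ({(0, 1), (S.h, 1), (1, 0), (1, S.h)} : Finset (S × S)) := fun _ _ => Iff.rfl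
  have H1 := hB 0
  have H2 := hB 1
  have H3 := hB 2
  simp only [e1, e2, e3] at H1 H2 H3
  -- Each `rᵢ` is the largest subalgebra omitting one pair: `(1, 0)`, `(h, 0)`, `(1, h)`
  -- respectively. The other excluded pairs are those that generate the omitted one, as these sums
  -- show.
  have c1 : ((1, 0) : S × S) ∈ B → (S.h, 0) ∈ B := fun k => B.add_mem k k
  have c2 : ((1, 0) : S × S) ∈ B → (1, S.h) ∈ B := fun k => B.add_mem k hhh
  have c3 : ((0, 1) : S × S) ∈ B → (1, S.h) ∈ B := fun k => B.add_mem k h11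
  have c4 : ((S.h, 1) : S × S) ∈ B → (1, S.h) ∈ B := fun k => B.add_mem k h11
  by_contra hn
  rcases a.exists_eq with rfl | rfl | rfl <;> rcases b.exists_eq with rfl | rfl | rfl
  · exact hn h00
  · exact absurd hab (by decide)
  · exact absurd hab (by decide)
  · exact H2 (key _ (by simpa using ⟨hn, mt c1 hn⟩)) (by decide)
  · exact hn hhh
  · exact absurd hab (by decide)
  · exact H1 (key _ (by simpa using hn)) (by decide)
  · exact H3 (key _ (by simpa using ⟨mt c3 hn, mt c4 hn, mt c2 hn, hn⟩)) (by decide)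
  · exact hn h11

theorem S.mul_eq_or (a b : S) : a * b = b ∨ b * a = a := by
  revert a b; decide

/-- A subalgebra of `S²` is determined by the relations `r₁`, `r₂`, `r₃` that it and its converse
satisfy. -/
theorem mem_of_forall_rel (B : Subsemiring (S × S)) {a b : S}
    (hB : ∀ i : Fin 3, (∀ p ∈ B, ![p.1, p.2] ∈ smallStructure.rel i) →
      ![a, b] ∈ smallStructure.rel i)
    (hB' : ∀ i : Fin 3, (∀ p ∈ B, ![p.2, p.1] ∈ smallStructure.rel i) →
      ![b, a] ∈ smallStructure.rel i) :
    (a, b) ∈ B := by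
  rcases S.mul_eq_or a b with h | h
  · exact mem_of_forall_rel_of_le B hB h
  · have : (b, a) ∈ B.comap (RingEquiv.prodComm : S × S ≃+* S × S).toRingHom :=
      mem_of_forall_rel_of_le _ (fun i hi => hB' i fun p hp => hi p.swap hp) h
    exact this

/-! ### Interpolation on compact spaces -/

/-- **Baker–Pixley**: let `T` be an algebra of `S`-valued functions on a space covered by finitely
many pieces such that every two pieces admit a member of `T` agreeing with `α` on both. Then some
member of `T` is equal to `α`. -/
theorem exists_eqOn_of_pairwise {X ι : Type*} (T : Subsemiring (X → S)) (α : X → S)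
    (C : ι → Set X) (hC : ∀ i j, ∃ t ∈ T, Set.EqOn t α (C i ∪ C j)) (s : Finset ι) :
    ∃ t ∈ T, Set.EqOn t α (⋃ i ∈ s, C i) := by
  classical
  induction hn : s.card using Nat.strong_induction_on generalizing s with
  | _ n ih =>
  subst hn
  rcases lt_or_ge 2 s.card with h2 | h2
  · obtain ⟨i, j, k, hi, hj, hk, hij, hik, hjk⟩ := Finset.two_lt_card_iff.1 h2
    obtain ⟨p, hp, hpE⟩ := ih _ (Finset.card_erase_lt_of_mem hi) _ rfl
    obtain ⟨q, hq, hqE⟩ := ih _ (Finset.card_erase_lt_of_mem hj) _ rfl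
    obtain ⟨r, hr, hrE⟩ := ih _ (Finset.card_erase_lt_of_mem hk) _ rfl
    refine ⟨p * q + q * r + r * p, T.add_mem (T.add_mem (T.mul_mem hp hq) (T.mul_mem hq hr))
      (T.mul_mem hr hp), fun x hx => ?_⟩
    simp only [Set.mem_iUnion] at hx
    obtain ⟨l, hl, hxl⟩ := hx
    have ev : ∀ {m : ι} {t : X → S}, Set.EqOn t α (⋃ i ∈ s.erase m, C i) → l ≠ m → t x = α x :=
      fun hE hm => hE (Set.mem_biUnion (Finset.mem_erase.2 ⟨hm, hl⟩) hxl)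
    change p x * q x + q x * r x + r x * p x = α x
    by_cases h1 : l = i
    · subst h1
      rw [ev hqE hij, ev hrE hik, S.majority_right]
    · by_cases h3 : l = j
      · subst h3
        rw [ev hpE hij.symm, ev hrE hjk, S.majority_mid]
      · rw [ev hpE h1, ev hqE h3, S.majority_left]
  · rcases s.eq_empty_or_nonempty with rfl | ⟨i, hi⟩
    · exact ⟨0, T.zero_mem, by simp⟩
    · have : ∃ j, s ⊆ {i, j} := by
        have hc : (s.erase i).card ≤ 1 := by rw [Finset.card_erase_of_mem hi]; omega
        have : Nonempty ι := ⟨i⟩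
        obtain ⟨j, hj⟩ := Finset.card_le_one_iff_subset_singleton.1 hc
        exact ⟨j, fun l hl => by
          by_cases h : l = i
          · simp [h]
          · exact Finset.mem_insert_of_mem (hj (Finset.mem_erase.2 ⟨h, hl⟩))⟩
      obtain ⟨j, hj⟩ := this
      obtain ⟨t, ht, hE⟩ := hC i j
      refine ⟨t, ht, hE.mono fun x hx => ?_⟩
      simp only [Set.mem_iUnion] at hx
      obtain ⟨l, hl, hxl⟩ := hx
      rcases Finset.mem_insert.1 (hj hl) with rfl | h
      · exact Or.inl hxl
      · rw [Finset.mem_singleton] at h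
        exact Or.inr (h ▸ hxl)

/-- An algebra of continuous `S`-valued functions on a compact space contains each continuous
function that it interpolates at any two points. -/
theorem mem_of_forall_pair {X : Type*} [TopologicalSpace X] [CompactSpace X]
    (T : Subsemiring (X → S)) (hT : ∀ t ∈ T, Continuous t) {α : X → S} (hα : Continuous α)
    (h : ∀ x y, ∃ t ∈ T, t x = α x ∧ t y = α y) : α ∈ T := by
  have hopen : ∀ t : T, IsOpen {x | t.1 x = α x} := fun t =>
    (isOpen_discrete {p : S × S | p.1 = p.2}).preimage ((hT t t.2).prodMk hα)
  obtain ⟨F, hF⟩ := (isCompact_univ (X := X × X)).elim_finite_subcover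
    (fun t : T => {x | t.1 x = α x} ×ˢ {x | t.1 x = α x})
    (fun t => (hopen t).prod (hopen t)) (fun p _ => by
      obtain ⟨t, ht, h1, h2⟩ := h p.1 p.2
      exact Set.mem_iUnion.2 ⟨⟨t, ht⟩, h1, h2⟩)
  classical
  -- The cells of the partition collect the points at which the same members of `F` agree with `α`.
  -- There are finitely many, and a member of `F` correct at one point is correct on its whole cell.
  let c : X → (F → Prop) := fun x t => t.1.1 x = α x
  obtain ⟨t, ht, hE⟩ := exists_eqOn_of_pairwise T α (fun k : Set.range c => c ⁻¹' {k.1}) (by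
    rintro ⟨_, x, rfl⟩ ⟨_, y, rfl⟩
    obtain ⟨t, htF, hx, hy⟩ : ∃ t ∈ F, t.1 x = α x ∧ t.1 y = α y := by
      obtain ⟨t, htF, ht⟩ := Set.mem_iUnion₂.1 (hF (Set.mem_univ (x, y)))
      exact ⟨t, htF, ht.1, ht.2⟩
    refine ⟨t, t.2, ?_⟩
    rintro z (hz | hz)
    · exact (congrFun (Set.mem_singleton_iff.1 hz) ⟨t, htF⟩).mpr hx
    · exact (congrFun (Set.mem_singleton_iff.1 hz) ⟨t, htF⟩).mpr hy) Finset.univ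
  convert ht
  funext x
  exact (hE (Set.mem_biUnion (Finset.mem_coe.2 (Finset.mem_univ ⟨c x, x, rfl⟩)) rfl)).symm

/-- An algebra of morphisms on a compact space that determines the relations contains all
morphisms. -/
theorem mem_of_mem_dualE {X : StrSpace.{u} smallSig} [CompactSpace X]
    (T : Subsemiring (X → S)) (hT : T ≤ dualE smallStructure X)
    (hrel : ∀ (i : Fin 3) (x y : X), (∀ t ∈ T, ![t x, t y] ∈ smallStructure.rel i) →
      ![x, y] ∈ X.rel i)
    {α : X → S} (hα : α ∈ dualE smallStructure X) : α ∈ T := by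
  refine mem_of_forall_pair T (fun t ht => (hT ht).continuous) (IsHom.continuous hα) fun x y => ?_
  have hmap : ∀ (i : Fin 3) (x y : X), ![x, y] ∈ X.rel i → ![α x, α y] ∈ smallStructure.rel i := by
    intro i x y hxy
    have := IsHom.map_rel hα i _ hxy
    have e : α ∘ ![x, y] = ![α x, α y] := by ext j; fin_cases j <;> rfl
    exact e ▸ this
  let ev : (X → S) →+* S × S :=
    (Pi.evalRingHom (fun _ : X => S) x).prod (Pi.evalRingHom (fun _ : X => S) y)
  have : (α x, α y) ∈ T.map ev := by
    refine mem_of_forall_rel _ (fun i hi => hmap i x y (hrel i x y fun t ht => ?_))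
      (fun i hi => hmap i y x (hrel i y x fun t ht => ?_))
    · exact hi _ ⟨t, ht, rfl⟩
    · exact hi _ ⟨t, ht, rfl⟩
  obtain ⟨t, ht, he⟩ := this
  exact ⟨t, ht, congrArg Prod.fst he, congrArg Prod.snd he⟩


/-! ### Spaces in `IS_cP⁺(M)` -/

theorem InIScP.compactSpace {τ : Sig} {M : AlterEgo τ} {X : StrSpace.{u} τ} (hX : InIScP M X) :
    CompactSpace X := by
  obtain ⟨Ω, C, hC, -, hcl, f, -, g, hg, hgf, -⟩ := hX
  have : CompactSpace (M.toStrSpace.power Ω) :=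
    inferInstanceAs (CompactSpace (Ω → S))
  have : CompactSpace ((M.toStrSpace.power Ω).sub C hC) :=
    (isCompact_iff_compactSpace (X := M.toStrSpace.power Ω) (s := C)).1 hcl.isCompact
  exact hgf.surjective.compactSpace hg.continuous

/-- The structure of a member of `IS_cP⁺(M)` is the initial one for some family of morphisms. -/
theorem InIScP.exists_family {τ : Sig} {M : AlterEgo τ} {X : StrSpace.{u} τ} (hX : InIScP M X) :
    ∃ (Ω : Type u) (π : Ω → dualE M X),
      (∀ x y, (∀ ω, (π ω).1 x = (π ω).1 y) → x = y) ∧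
      (∀ k (x : Fin (τ.arH k) → X), (∀ ω, (π ω).1 ∘ x ∈ M.dom k) → x ∈ X.dom k) ∧
      ∀ r (x : Fin (τ.arR r) → X), (∀ ω, (π ω).1 ∘ x ∈ M.rel r) → x ∈ X.rel r := by
  obtain ⟨Ω, C, hC, -, -, f, hf, g, hg, hgf, -⟩ := hX
  have comp_eq : ∀ {n : ℕ} (x : Fin n → X), g ∘ f ∘ x = x := fun x => funext fun i => hgf (x i)
  refine ⟨Ω, fun ω => ⟨fun x => (f x).1 ω, ?_⟩, ?_, ?_, ?_⟩
  · refine ⟨(continuous_apply (A := fun _ : Ω => S) ω).comp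
      (continuous_induced_dom.comp hf.continuous), fun j x => ?_, fun k x hx => ?_,
      fun r x hx => hf.map_rel r x hx ω⟩
    · exact congrArg (fun z => z.1 ω) (hf.map_op j x)
    · obtain ⟨hy, e⟩ := hf.map_pop k x hx
      exact ⟨hy ω, congrArg (fun z => z.1 ω) e⟩
  · exact fun x y h => hgf.injective (Subtype.ext (funext h))
  · intro k x hx
    obtain ⟨hy, -⟩ := hg.map_pop k (f ∘ x) hx
    rwa [comp_eq] at hy
  · intro r x hx
    have := hg.map_rel r (f ∘ x) hx
    rwa [comp_eq] at this

theorem comp_eq_vecCons {X Y : Type*} (t : X → Y) (x : Fin 2 → X) : t ∘ x = ![t (x 0), t (x 1)] := by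
  ext j; fin_cases j <;> rfl

/-! ### Duality and injectivity -/

theorem yieldsDuality_smallStructure : YieldsDuality.{u} smallStructure := by
  intro A _ hA
  constructor
  · obtain ⟨I, B, ⟨e⟩⟩ := hA
    intro a b hab
    refine e.injective (Subtype.ext (funext fun i => ?_))
    exact congrFun (congrArg Subtype.val hab)
      (((Pi.evalRingHom (fun _ : I => S) i).comp B.subtype).comp e.toRingHom)
  · intro α
    have := (inIScP_dualD smallStructure A).compactSpace
    let ι : A →+* (dualD smallStructure A → S) :=
      (dualE smallStructure (dualD smallStructure A)).subtype.comp (evalHom smallStructure A)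
    have hmem : α.1 ∈ ι.rangeS := by
      refine mem_of_mem_dualE _ ?_ ?_ α.2
      · rintro _ ⟨a, rfl⟩
        exact (evalHom smallStructure A a).2
      · intro i φ ψ h a
        have e := comp_eq_vecCons (fun χ : A →+* S => χ a) ![φ, ψ]
        change (fun χ : A →+* S => χ a) ∘ ![φ, ψ] ∈ smallStructure.rel i
        exact e ▸ h (ι a) ⟨a, rfl⟩
    obtain ⟨a, ha⟩ := hmem
    exact ⟨a, Subtype.ext ha⟩

/-- The restrictions to `X` of morphisms on `Y` determine the relations of `X`, because `f` reflects
relations and the coordinate morphisms of `Y` determine those of `Y`. Hence every morphism on `X` is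
such a restriction. -/
theorem isInjectiveIn_smallStructure : IsInjectiveIn.{u} smallStructure := by
  intro X Y hX hY f hf α hα
  have := hX.compactSpace
  obtain ⟨Ω, π, -, -, hrel⟩ := hY.exists_family
  let res : (Y → S) →+* (X → S) := RingHom.pi fun x => Pi.evalRingHom (fun _ : Y => S) (f x)
  have hmem : (α : X → S) ∈ (dualE smallStructure Y).map res := by
    refine mem_of_mem_dualE _ ?_ ?_ hα
    · rintro _ ⟨β, hβ, rfl⟩
      have hβ : IsHom Y smallStructure.toStrSpace β := hβ
      refine ⟨hβ.continuous.comp hf.isHom.continuous, fun g => g.elim, fun k x hx => ?_,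
        fun r x hx => hβ.map_rel r _ (hf.isHom.map_rel r x hx)⟩
      obtain ⟨hy, e⟩ := hf.isHom.map_pop k x hx
      obtain ⟨hz, e'⟩ := hβ.map_pop k _ hy
      exact ⟨hz, (congrArg β e).trans e'⟩
    · intro i x y h
      refine hf.reflect_rel i _ (hrel i _ fun ω => ?_)
      have e := comp_eq_vecCons (fun z => (π ω).1 (f z)) ![x, y]
      exact e ▸ h _ ⟨_, (π ω).2, rfl⟩
  obtain ⟨β, hβ, e⟩ := hmem
  exact ⟨β, hβ, e⟩

/-! ### Homomorphisms `E(X) → S` are evaluations -/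

namespace S

theorem add_eq_zero_left : ∀ {a b : S}, a + b = 0 → a = 0 := by decide

theorem mul_eq_one_left : ∀ {a b : S}, a * b = 1 → a = 1 := by decide

/-- Adding `1` flips the ring coordinate, so `1 + a` expresses the negation of `a = 1` within the
algebra. -/
theorem one_add_eq_one_iff : ∀ {a : S}, 1 + a = 1 ↔ a ≠ 1 := by decide

/-- The quasi-identity form of `b = 0 ∨ z ≠ 0`. -/
theorem absorb_iff : ∀ {b z : S}, (1 + 1) * b + (1 + 1) * z = (1 + 1) * z ↔ (z = 0 → b = 0) := by
  decide

instance : Nontrivial S := ⟨0, 1, by decide⟩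

instance : NoZeroDivisors S := ⟨by decide⟩

end S

theorem exists_forall_of_finset {X ι : Type*} [TopologicalSpace X] [CompactSpace X]
    {K : ι → Set X} (hK : ∀ i, IsClosed (K i)) (h : ∀ F : Finset ι, ∃ x, ∀ i ∈ F, x ∈ K i) :
    ∃ x, ∀ i, x ∈ K i := by
  obtain ⟨x, -, hx⟩ := isCompact_univ.inter_iInter_nonempty K hK fun F => by
    obtain ⟨x, hx⟩ := h F
    exact ⟨x, Set.mem_univ x, Set.mem_iInter₂.2 hx⟩
  exact ⟨x, Set.mem_iInter.1 hx⟩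

section points

variable {X : Type*} [TopologicalSpace X] [CompactSpace X] (T : Subsemiring (X → S))
  (hT : ∀ t ∈ T, Continuous t) (u : T →+* S)

include hT

/-- A homomorphism into `S` on an algebra of continuous functions takes the value `1` on the same
functions as the evaluation at some point. -/
theorem exists_point_one : ∃ x, ∀ t : T, u t = 1 ↔ t.1 x = 1 := by
  classical
  refine exists_forall_of_finset (K := fun t : T => {x | u t = 1 ↔ t.1 x = 1})
    (fun t => (isClosed_discrete {s : S | u t = 1 ↔ s = 1}).preimage (hT t t.2)) fun F => ?_
  let b : T → T := fun t => if u t = 1 then t else 1 + t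
  have hub : ∀ t, u (b t) = 1 := fun t => by
    by_cases h : u t = 1
    · simp [b, h]
    · simpa [b, h] using S.one_add_eq_one_iff.2 h
  have hprod : u (∏ t ∈ F, b t) = 1 := by simp [hub]
  -- If the product were nowhere `1`, then `1 + ∏ = 1` would hold identically, and `u` would carry
  -- it to `1 + 1 = 1`. This also excludes an empty `X`.
  obtain ⟨x, hx⟩ : ∃ x, (∏ t ∈ F, b t).1 x = 1 := by
    by_contra! hne
    have : 1 + ∏ t ∈ F, b t = 1 :=
      Subtype.ext (funext fun x => S.one_add_eq_one_iff.2 (hne x))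
    have := congrArg u this
    rw [map_add, map_one] at this
    exact S.one_add_eq_one_iff.1 this hprod
  refine ⟨x, fun t ht => ?_⟩
  rw [← Finset.mul_prod_erase F b ht] at hx
  have hbx : (b t).1 x = 1 := S.mul_eq_one_left hx
  by_cases h : u t = 1
  · simpa [b, h] using hbx
  · simp only [b, h, if_false] at hbx
    have : t.1 x ≠ 1 := S.one_add_eq_one_iff.1 hbx
    simp [h, this]

/-- A homomorphism into `S` on an algebra of continuous functions takes the value `0` on the same
functions as the evaluation at some point. -/
theorem exists_point_zero : ∃ x, ∀ t : T, u t = 0 ↔ t.1 x = 0 := by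
  classical
  refine exists_forall_of_finset (K := fun t : T => {x | u t = 0 ↔ t.1 x = 0})
    (fun t => (isClosed_discrete {s : S | u t = 0 ↔ s = 0}).preimage (hT t t.2)) fun F => ?_
  -- A zero sum has zero summands and a nonzero product has nonzero factors, so one point with `∑ =
  -- 0` and `∏ ≠ 0` settles all of `F`. Without such a point, the identity of `S.absorb_iff` would
  -- hold pointwise and pass to `u`.
  set Z := F.filter fun t => u t = 0 with hZ
  set N := F.filter fun t => u t ≠ 0 with hN
  have huz : u (∑ t ∈ Z, t) = 0 := by
    rw [map_sum]
    exact Finset.sum_eq_zero fun t ht => (Finset.mem_filter.1 ht).2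
  have hub : u (∏ t ∈ N, t) ≠ 0 := by
    rw [map_prod]
    exact Finset.prod_ne_zero_iff.2 fun t ht => (Finset.mem_filter.1 ht).2
  obtain ⟨x, hz, hb⟩ : ∃ x, (∑ t ∈ Z, t).1 x = 0 ∧ (∏ t ∈ N, t).1 x ≠ 0 := by
    by_contra! hne
    have : (1 + 1) * ∏ t ∈ N, t + (1 + 1) * ∑ t ∈ Z, t = (1 + 1) * ∑ t ∈ Z, t :=
      Subtype.ext (funext fun x => S.absorb_iff.2 (hne x))
    have := congrArg u this
    simp only [map_add, map_mul, map_one] at this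
    exact hub (S.absorb_iff.1 this huz)
  refine ⟨x, fun t ht => ?_⟩
  by_cases h : u t = 0
  · rw [← Finset.add_sum_erase Z (fun t => t) (Finset.mem_filter.2 ⟨ht, h⟩)] at hz
    exact iff_of_true h (S.add_eq_zero_left hz)
  · rw [← Finset.mul_prod_erase N (fun t => t) (Finset.mem_filter.2 ⟨ht, h⟩)] at hb
    exact iff_of_false h fun h0 => hb (mul_eq_zero_of_left h0 _)

end points

/-- The two conditions fix `c` and account for the whole table of `λ₁`; they exclude `(1, 0)`
because `c` would be both `1` and `0`. -/
theorem S.lam_eq : ∀ {a b c : S}, (c = 1 ↔ a = 1) → (c = 0 ↔ b = 0) →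
    (a, b) ∉ ({(1, 0)} : Finset (S × S)) ∧ lam₁Table a b = c := by
  decide

/-- Every homomorphism `E(X) → S` is the evaluation at a point of `X`. -/
theorem evalPt_surjective {X : StrSpace.{u} smallSig} (hX : InIScP smallStructure X) :
    Function.Surjective (evalPt smallStructure X) := by
  intro (u : dualE smallStructure X →+* S)
  have := hX.compactSpace
  obtain ⟨Ω, π, -, hdom, -⟩ := hX.exists_family
  have hcont : ∀ t ∈ dualE smallStructure X, Continuous t := fun t ht => IsHom.continuous ht
  obtain ⟨x, hx⟩ := exists_point_one _ hcont u
  obtain ⟨y, hy⟩ := exists_point_zero _ hcont u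
  have hxy : (![x, y] : Fin 2 → X) ∈ X.dom () := hdom () _ fun ω =>
    (S.lam_eq (hx (π ω)) (hy (π ω))).1
  refine ⟨X.pop () ⟨_, hxy⟩, RingHom.ext fun α => ?_⟩
  obtain ⟨h, e⟩ := IsHom.map_pop α.2 () _ hxy
  exact e.trans (S.lam_eq (hx α) (hy α)).2

/-! ### Full duality -/

theorem isIsom_evalPt {X : StrSpace.{u} smallSig} (hX : InIScP smallStructure X) :
    IsIsom X (dualD smallStructure (dualE smallStructure X)) (evalPt smallStructure X) := by
  have := hX.compactSpace
  obtain ⟨Ω, π, hsep, hdom, hrel⟩ := hX.exists_family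
  have hinj : Function.Injective (evalPt smallStructure X) := fun x y h =>
    hsep x y fun ω => RingHom.congr_fun (h : (_ : dualE smallStructure X →+* S) = _) (π ω)
  let e := Equiv.ofBijective _ ⟨hinj, evalPt_surjective hX⟩
  have hcont : Continuous (evalPt smallStructure X) :=
    continuous_induced_rng.2 (continuous_pi fun α => IsHom.continuous α.2)
  have : T2Space (dualD smallStructure (dualE smallStructure X)) :=
    T2Space.of_injective_continuous (Y := dualE smallStructure X → S)
      (f := fun φ : dualE smallStructure X →+* S => (φ : _ → S))
      (DFunLike.coe_injective (F := dualE smallStructure X →+* S)) continuous_induced_dom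
  have hom : IsHom X (dualD smallStructure (dualE smallStructure X)) (evalPt smallStructure X) := by
    refine ⟨hcont, fun g => g.elim, fun k x hx => ?_, fun r x hx α => IsHom.map_rel α.2 r x hx⟩
    exact ⟨fun α => (IsHom.map_pop α.2 k x hx).choose,
      RingHom.ext fun α => (IsHom.map_pop α.2 k x hx).choose_spec⟩
  have hes : ∀ z, evalPt smallStructure X (e.symm z) = z := e.apply_symm_apply
  have comp_eq : ∀ {n : ℕ} (x : Fin n → dualD smallStructure (dualE smallStructure X)),
      evalPt smallStructure X ∘ e.symm ∘ x = x := fun x => funext fun i => hes (x i)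
  have hdom' : ∀ k x, evalPt smallStructure X ∘ x ∈
      (dualD smallStructure (dualE smallStructure X)).dom k → x ∈ X.dom k :=
    fun k x hx => hdom k x fun ω => hx (π ω)
  -- A continuous bijection from a compact space to a Hausdorff one is a homeomorphism. The inverse
  -- preserves domains and relations because the `π ω`, being members of `E(X)`, already determine
  -- them on `X`.
  refine ⟨hom, e.symm, ⟨Continuous.continuous_symm_of_equiv_compact_to_t2 (f := e) hcont, fun g => g.elim, fun k x hx => ?_,
    fun r x hx => hrel r _ fun ω => ?_⟩, e.left_inv, e.right_inv⟩
  · have hx' : e.symm ∘ x ∈ X.dom k := hdom' k _ (by rwa [comp_eq])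
    refine ⟨hx', hinj ?_⟩
    obtain ⟨hy, he⟩ := hom.map_pop k _ hx'
    rw [hes, he]
    congr 1
    exact Subtype.ext (comp_eq x).symm
  · have := (comp_eq x).symm ▸ hx
    exact this (π ω)

end NatDual

theorem corollary4p6 : NatDual.YieldsStrongDuality.{u} NatDual.smallStructure :=
  ⟨⟨NatDual.yieldsDuality_smallStructure, fun _ => NatDual.isIsom_evalPt⟩,
    NatDual.isInjectiveIn_smallStructure⟩
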